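/- Let $\kappa$ be an indeterminate, $N\ge 1$, and let $S_N$ act on $\mathbb{Q}(\kappa)[x_1,\dots,x_N]$ by $w x_i=x_{w(i)}$ and on compositions $\alpha\in\mathbb{N}_0^N$ by $(w\alpha)_i=\alpha_{w^{-1}(i)}$. For $1\le i\le N$ put $$\mathcal{D}_i(\kappa)f=\frac{\partial f}{\partial x_i}+\kappa\sum_{j\ne i}\frac{f-(i\,j)f}{x_i-x_j},\qquad \mathcal{U}_i(\kappa)f=\mathcal{D}_i(\kappa)(x_if)-\kappa\sum_{j<i}(j\,i)f .$$ For $\alpha\in\mathbb{N}_0^N$ let $\ell(\alpha)=\max\{j:\alpha_j>0\}$, let $$r(\alpha,i)=\#\{j:\alpha_j>\alpha_i\}+\#\{j\le i:\alpha_j=\alpha_i\},$$ and let $\alpha^+$ be the nonincreasing rearrangement of $\alpha$. Write $\alpha\succ\beta$ if $\alpha\ne\beta$ and $\sum_{i\le j}\alpha_i\ge\sum_{i\le j}\beta_i$ for all $j$; write $\alpha\rhd\beta$ if $\sum_i\alpha_i=\sum_i\beta_i$ and either $\alpha^+\succ\beta^+$, or $\alpha^+=\beta^+$ and $\alpha\succ\beta$.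 The ($x$-monic) nonsymmetric Jack polynomial $\zeta^x_\alpha(\kappa)$ is the polynomial of the form $x^\alpha+\sum_{\beta\lhd\alpha}A_\beta x^\beta$, $A_\beta\in\mathbb{Q}(\kappa)$, with $$\mathcal{U}_i(\kappa)\,\zeta^x_\alpha(\kappa)=\bigl((N-r(\alpha,i))\kappa+\alpha_i+1\bigr)\,\zeta^x_\alpha(\kappa)\quad\text{for } 1\le i\le N .$$ Let $\alpha\in\mathbb{N}_0^N$ be nonzero with $\ell(\alpha)=k$, let $\theta_k=(1,2)(2,3)\cdots(k-1,k)\in S_N$ (the identity if $k=1$), and let $\widetilde\alpha=(\alpha_k-1,\alpha_1,\dots,\alpha_{k-1},0,\dots,0)\in\mathbb{N}_0^N$. Then $\zeta^x_\alpha(\kappa)$ and $\zeta^x_{\widetilde\alpha}(\kappa)$ exist and are unique, and $$\mathcal{D}_k(\kappa)\,\zeta^x_\alpha(\kappa)=\frac{(k-r(\alpha,k))\kappa+\alpha_k}{(k+1-r(\alpha,k))\kappa+\alpha_k}\,\bigl((N+1-r(\alpha,k))\kappa+\alpha_k\bigr)\,\theta_k^{-1}\zeta^x_{\widetilde\alpha}(\kappa).$$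 -/

import Mathlib

open MvPolynomial

noncomputable section

namespace NSJack

/-- The field `ℚ(κ)` of rational functions in the formal parameter `κ`. -/
abbrev K : Type := RatFunc ℚ

/-- The formal parameter `κ`. -/
def kap : K := RatFunc.X

/-- Polynomials in `x₁, …, x_N` over `ℚ(κ)`; the variable `x_{i+1}` is `X i`, `i : Fin N`.
A permutation `w` acts on them by `x_i ↦ x_{w(i)}`, which is `rename w`. -/
abbrev Pol (N : ℕ) : Type := MvPolynomial (Fin N) K

/-- The difference `f - (i j) f` is divisible by `x_i - x_j`. -/
theorem X_sub_X_dvd {N : ℕ} (i j : Fin N) (f : Pol N) :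
    (X i - X j : Pol N) ∣ f - rename (Equiv.swap i j) f := by
  induction f using MvPolynomial.induction_on with
  | C a => simp
  | add p q hp hq =>
    rw [map_add, add_sub_add_comm]
    exact dvd_add hp hq
  | mul_X p n hp =>
    have hX : (X i - X j : Pol N) ∣ X n - rename (Equiv.swap i j) (X n : Pol N) := by
      rw [rename_X]
      by_cases h1 : n = i
      · subst h1; simp
      · by_cases h2 : n = j
        · subst h2
          rw [Equiv.swap_apply_right]
          exact ⟨-1, by ring⟩
        · rw [Equiv.swap_apply_of_ne_of_ne h1 h2]; simp
    have : p * X n - rename (Equiv.swap i j) (p * X n) =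
        (p - rename (Equiv.swap i j) p) * X n +
          rename (Equiv.swap i j) p * (X n - rename (Equiv.swap i j) (X n : Pol N)) := by
      rw [map_mul]; ring
    rw [this]
    exact dvd_add (Dvd.dvd.mul_right hp _) (Dvd.dvd.mul_left hX _)

/-- The polynomial `(f - (i j) f) / (x_i - x_j)`. -/
def divDiff {N : ℕ} (i j : Fin N) (f : Pol N) : Pol N :=
  Classical.choose (X_sub_X_dvd i j f)

theorem divDiff_spec {N : ℕ} (i j : Fin N) (f : Pol N) :
    f - rename (Equiv.swap i j) f = (X i - X j) * divDiff i j f :=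
  Classical.choose_spec (X_sub_X_dvd i j f)

/-- The Dunkl operator `𝒟_i(κ)`. -/
def dunkl {N : ℕ} (i : Fin N) (f : Pol N) : Pol N :=
  pderiv i f + C kap * ∑ j ∈ Finset.univ.erase i, divDiff i j f

/-- The operator `𝒰_i(κ) f = 𝒟_i(κ) (x_i f) - κ ∑_{j < i} (j i) f`. -/
def opU {N : ℕ} (i : Fin N) (f : Pol N) : Pol N :=
  dunkl i (X i * f) - C kap * ∑ j ∈ Finset.Iio i, rename (Equiv.swap j i) f

/-- The rank function `r(α, i)`. -/
def rank {N : ℕ} (α : Fin N →₀ ℕ) (i : Fin N) : ℕ :=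
  (Finset.univ.filter (fun j => α i < α j)).card +
    (Finset.univ.filter (fun j => j ≤ i ∧ α j = α i)).card

/-- The eigenvalue `ξ_i(α; κ) = (N - r(α, i)) κ + α_i + 1`. -/
def xi {N : ℕ} (α : Fin N →₀ ℕ) (i : Fin N) : K :=
  ((N : K) - (rank α i : K)) * kap + (α i : K) + 1

/-- The partition `α⁺`: the entries of `α` in nonincreasing order. -/
def plus {N : ℕ} (α : Fin N →₀ ℕ) : Fin N → ℕ :=
  fun i => α (Tuple.sort (⇑α) (Fin.rev i))

theorem plus_antitone {N : ℕ} (α : Fin N →₀ ℕ) : Antitone (plus α) :=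
  fun _ _ h => Tuple.monotone_sort (⇑α) (Fin.rev_le_rev.2 h)

/-- The strict dominance order `a ≻ b`. -/
def Dominates {N : ℕ} (a b : Fin N → ℕ) : Prop :=
  a ≠ b ∧ ∀ j : Fin N, ∑ i ∈ Finset.Iic j, b i ≤ ∑ i ∈ Finset.Iic j, a i

/-- The order `α ▷ β` on compositions. -/
def TriGT {N : ℕ} (α β : Fin N →₀ ℕ) : Prop :=
  ∑ i, α i = ∑ i, β i ∧
    (Dominates (plus α) (plus β) ∨ (plus α = plus β ∧ Dominates (⇑α) (⇑β)))

/-- `f` is the `x`-monic nonsymmetric Jack polynomial of label `α`: it is a simultaneous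
eigenvector of the `𝒰_i(κ)` with eigenvalues `ξ_i(α; κ)`, and it has the form
`x^α + ∑_{β ◁ α} A_β x^β`. -/
def IsNSJack {N : ℕ} (α : Fin N →₀ ℕ) (f : Pol N) : Prop :=
  (∀ i, opU i f = C (xi α i) * f) ∧ coeff α f = 1 ∧
    ∀ β, coeff β f ≠ 0 → β = α ∨ TriGT α β

/-- The nonsymmetric Jack polynomial `ζ^x_α(κ)`. -/
def zeta {N : ℕ} (α : Fin N →₀ ℕ) : Pol N := Classical.epsilon (IsNSJack α)

/-- The length `ℓ(α) = max {j : α_j > 0}` (positions counted from `1`), with `ℓ(0) = 0`. -/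
def len {N : ℕ} (α : Fin N →₀ ℕ) : ℕ := α.support.sup (fun j => (j : ℕ) + 1)

/-- The cyclic shift `θ = (1,2)(2,3)⋯(k-1,k)`, that is, `1 ↦ 2 ↦ ⋯ ↦ k ↦ 1`, where the index
`k : Fin N` stands for the position `k + 1`; for the first position it is the identity. -/
def theta {N : ℕ} (k : Fin N) : Equiv.Perm (Fin N) := Fin.cycleRange k

/-- `α̃ = θ (α - ε(k)) = (α_k - 1, α_1, …, α_{k-1}, α_{k+1}, …)`,
where `(w α)_i = α_{w⁻¹(i)}`. -/
def tilde {N : ℕ} (k : Fin N) (α : Fin N →₀ ℕ) : Fin N →₀ ℕ :=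
  (α - Finsupp.single k 1).equivMapDomain (theta k)

end NSJack

end

noncomputable section

namespace NSJack

/-! ### Algebra of the Dunkl operators -/

/-! Two moves on labels generate everything. Raising: `raise`, f ↦ x_N θ_N⁻¹ f, satisfies 𝒰_i ∘
raise = raise ∘ 𝒰_{i+1} for i < N and 𝒰_N ∘ raise = raise ∘ (𝒰_1 + 1), so it sends ζ_α̃ to ζ_α when
α_N > 0 (`IsNSJack.raise`). Swapping: with s = (a b), b = a + 1, and α_a < α_b, the combination s
ζ_α + c ζ_α with a suitable scalar c is ζ_{sα} (`IsNSJack.swap`). Existence follows by induction on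
the degree and on the position of the last nonzero entry.

Uniqueness rests on triangularity (`opU_monomial_sub_mem_lower`): at a maximal exponent γ of a joint
eigenvector the operators act by ξ(γ), and since κ is transcendental ξ(γ) determines γ. So any joint
eigenvector with spectrum ξ(α) contains x^α.

The formula for 𝒟_k is proved downward from k = N. There ζ_α = `raise` ζ_α̃ and 𝒟_N ∘ raise = θ_N⁻¹
𝒰_1, so the factor is an eigenvalue. For k < N put a = k, b = k + 1, g = ζ_{sα}; then ζ_α = s g + c
g with c = κ / (ξ_a(α) - ξ_b(α)). As α vanishes from b on, 𝒟_b ζ_α = 0 (`IsNSJack.dunkl_eq_zero`).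
This yields 𝒟_a g = -c s 𝒟_b g, hence 𝒟_a ζ_α = (1 - c²) s 𝒟_b g (`IsNSJack.dunkl_swap`). The
factors 1 - c² telescope to the stated quotient. -/

theorem X_sub_X_ne_zero {N : ℕ} {i j : Fin N} (h : i ≠ j) : (X i - X j : Pol N) ≠ 0 :=
  sub_ne_zero.2 fun e => h (X_injective e)

theorem divDiff_eq {N : ℕ} {i j : Fin N} (h : i ≠ j) {f g : Pol N}
    (hg : f - rename (Equiv.swap i j) f = (X i - X j) * g) : divDiff i j f = g :=
  mul_left_cancel₀ (X_sub_X_ne_zero h) (by rw [← divDiff_spec, hg])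

theorem divDiff_add {N : ℕ} {i j : Fin N} (h : i ≠ j) (f g : Pol N) :
    divDiff i j (f + g) = divDiff i j f + divDiff i j g := by
  refine divDiff_eq h ?_
  rw [mul_add, ← divDiff_spec, ← divDiff_spec, map_add]
  ring

theorem divDiff_C_mul {N : ℕ} {i j : Fin N} (h : i ≠ j) (c : K) (f : Pol N) :
    divDiff i j (C c * f) = C c * divDiff i j f := by
  refine divDiff_eq h ?_
  rw [mul_left_comm, ← divDiff_spec, map_mul, rename_C]
  ring

theorem rename_swap_rename {N : ℕ} (w : Equiv.Perm (Fin N)) (i j : Fin N) (f : Pol N) :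
    rename (Equiv.swap (w i) (w j)) (rename w f) = rename w (rename (Equiv.swap i j) f) := by
  rw [rename_rename, rename_rename]
  congr 2
  funext x
  simp only [Function.comp_apply, Equiv.swap_apply_def, w.injective.eq_iff]
  split_ifs <;> rfl

theorem rename_swap_swap {N : ℕ} (i j : Fin N) (f : Pol N) :
    rename (Equiv.swap i j) (rename (Equiv.swap i j) f) = f := by
  rw [rename_rename]
  have : (⇑(Equiv.swap i j) ∘ ⇑(Equiv.swap i j)) = id := by funext x; simp
  rw [this, rename_id_apply]

theorem rename_divDiff {N : ℕ} (w : Equiv.Perm (Fin N)) {i j : Fin N} (h : i ≠ j) (f : Pol N) :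
    rename w (divDiff i j f) = divDiff (w i) (w j) (rename w f) := by
  symm
  refine divDiff_eq (w.injective.ne h) ?_
  rw [rename_swap_rename, ← map_sub, divDiff_spec]
  simp

theorem dunkl_add {N : ℕ} (i : Fin N) (f g : Pol N) :
    dunkl i (f + g) = dunkl i f + dunkl i g := by
  unfold dunkl
  have : ∀ j ∈ Finset.univ.erase i, divDiff i j (f + g) = divDiff i j f + divDiff i j g :=
    fun j hj => divDiff_add (Finset.ne_of_mem_erase hj).symm f g
  rw [Finset.sum_congr rfl this, Finset.sum_add_distrib, map_add]
  ring

theorem dunkl_C_mul {N : ℕ} (i : Fin N) (c : K) (f : Pol N) :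
    dunkl i (C c * f) = C c * dunkl i f := by
  unfold dunkl
  have : ∀ j ∈ Finset.univ.erase i, divDiff i j (C c * f) = C c * divDiff i j f :=
    fun j hj => divDiff_C_mul (Finset.ne_of_mem_erase hj).symm c f
  rw [Finset.sum_congr rfl this, ← Finset.mul_sum, pderiv_C_mul]
  ring

theorem rename_dunkl {N : ℕ} (w : Equiv.Perm (Fin N)) (i : Fin N) (f : Pol N) :
    rename w (dunkl i f) = dunkl (w i) (rename w f) := by
  unfold dunkl
  rw [map_add, map_mul, rename_C, map_sum, pderiv_rename w.injective]
  congr 2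
  refine Finset.sum_bij (fun j _ => w j) ?_ ?_ ?_ ?_
  · intro j hj; simpa using hj
  · intro a _ b _ h; exact w.injective h
  · intro b hb
    refine ⟨w.symm b, ?_, by simp⟩
    have : b ≠ w i := by simpa using hb
    simp only [Finset.mem_erase, Finset.mem_univ, and_true]
    rintro rfl
    simp at this
  · intro j hj
    exact rename_divDiff w (Finset.ne_of_mem_erase hj).symm f

theorem divDiff_X_mul_left {N : ℕ} {i j : Fin N} (h : i ≠ j) (f : Pol N) :
    divDiff i j (X i * f) = X i * divDiff i j f + rename (Equiv.swap i j) f := by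
  refine divDiff_eq h ?_
  rw [mul_add, mul_left_comm, ← divDiff_spec, map_mul, rename_X, Equiv.swap_apply_left]
  ring

theorem divDiff_X_mul_right {N : ℕ} {i j : Fin N} (h : i ≠ j) (f : Pol N) :
    divDiff i j (X j * f) = X j * divDiff i j f - rename (Equiv.swap i j) f := by
  refine divDiff_eq h ?_
  rw [mul_sub, mul_left_comm, ← divDiff_spec, map_mul, rename_X, Equiv.swap_apply_right]
  ring

theorem divDiff_X_mul_of_ne {N : ℕ} {i j m : Fin N} (h : i ≠ j) (hi : m ≠ i) (hj : m ≠ j)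
    (f : Pol N) : divDiff i j (X m * f) = X m * divDiff i j f := by
  refine divDiff_eq h ?_
  rw [mul_left_comm, ← divDiff_spec, map_mul, rename_X, Equiv.swap_apply_of_ne_of_ne hi hj]
  ring

theorem dunkl_X_mul_self {N : ℕ} (i : Fin N) (f : Pol N) :
    dunkl i (X i * f) = X i * dunkl i f + f +
      C kap * ∑ j ∈ Finset.univ.erase i, rename (Equiv.swap i j) f := by
  unfold dunkl
  have : ∀ j ∈ Finset.univ.erase i, divDiff i j (X i * f) =
      X i * divDiff i j f + rename (Equiv.swap i j) f :=
    fun j hj => divDiff_X_mul_left (Finset.ne_of_mem_erase hj).symm f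
  rw [Finset.sum_congr rfl this, Finset.sum_add_distrib, ← Finset.mul_sum, Derivation.leibniz,
    pderiv_X_self]
  simp only [smul_eq_mul]
  ring

theorem dunkl_X_mul_of_ne {N : ℕ} {i m : Fin N} (h : i ≠ m) (f : Pol N) :
    dunkl i (X m * f) = X m * dunkl i f - C kap * rename (Equiv.swap i m) f := by
  unfold dunkl
  have hm : m ∈ Finset.univ.erase i := by simp [h.symm]
  have : ∀ j ∈ (Finset.univ.erase i).erase m, divDiff i j (X m * f) = X m * divDiff i j f := by
    intro j hj
    simp only [Finset.mem_erase, Finset.mem_univ, and_true] at hj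
    exact divDiff_X_mul_of_ne hj.2.symm h.symm (Ne.symm hj.1) f
  rw [← Finset.add_sum_erase _ _ hm, ← Finset.add_sum_erase _ (fun j => divDiff i j f) hm,
    Finset.sum_congr rfl this, divDiff_X_mul_right h, ← Finset.mul_sum, Derivation.leibniz,
    pderiv_X_of_ne h.symm]
  simp only [smul_eq_mul]
  ring

/-! ### Intertwining relations for 𝒰_i under adjacent transpositions and raising. -/

theorem opU_add {N : ℕ} (i : Fin N) (f g : Pol N) : opU i (f + g) = opU i f + opU i g := by
  unfold opU
  simp only [mul_add, dunkl_add, map_add, Finset.sum_add_distrib]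
  ring

theorem opU_C_mul {N : ℕ} (i : Fin N) (c : K) (f : Pol N) :
    opU i (C c * f) = C c * opU i f := by
  unfold opU
  simp only [mul_left_comm (X i) (C c) f, dunkl_C_mul, map_mul, rename_C, ← Finset.mul_sum]
  ring

/-- Commuting 𝒟_i past x_i produces all swaps (i j); the subtracted sum in 𝒰_i removes those with j
< i. -/
theorem opU_eq {N : ℕ} (i : Fin N) (f : Pol N) :
    opU i f = X i * dunkl i f + f + C kap * ∑ j ∈ Finset.Ioi i, rename (Equiv.swap i j) f := by
  unfold opU
  have hd : Disjoint (Finset.Iio i) (Finset.Ioi i) := by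
    rw [Finset.disjoint_left]
    intro j h1 h2
    exact lt_asymm (Finset.mem_Iio.1 h1) (Finset.mem_Ioi.1 h2)
  have hu : Finset.univ.erase i = (Finset.Iio i).disjUnion (Finset.Ioi i) hd := by
    ext j
    simp [lt_or_lt_iff_ne]
  rw [dunkl_X_mul_self, hu, Finset.sum_disjUnion]
  simp only [Equiv.swap_comm _ i]
  ring

/-- 𝒟_i is equivariant, so the only failure of equivariance of 𝒰_i lies in the index set {j < i},
which gets replaced by its image. -/
theorem rename_opU {N : ℕ} (w : Equiv.Perm (Fin N)) (i : Fin N) (f : Pol N) :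
    rename w (opU i f) = dunkl (w i) (X (w i) * rename w f) -
      C kap * ∑ j ∈ (Finset.Iio i).image w, rename (Equiv.swap j (w i)) (rename w f) := by
  unfold opU
  rw [map_sub, rename_dunkl, map_mul, rename_X, map_mul, rename_C, map_sum,
    Finset.sum_image w.injective.injOn]
  simp only [rename_swap_rename]

theorem rename_swap_opU_of_ne {N : ℕ} {a b i : Fin N} (hab : (a : ℕ) + 1 = b) (ha : i ≠ a)
    (hb : i ≠ b) (f : Pol N) :
    opU i (rename (Equiv.swap a b) f) = rename (Equiv.swap a b) (opU i f) := by
  rw [rename_opU, Equiv.swap_apply_of_ne_of_ne ha hb]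
  have : (Finset.Iio i).image (Equiv.swap a b) = Finset.Iio i := by
    ext j
    simp only [Finset.mem_image, Finset.mem_Iio]
    have key : ∀ j, j < i → Equiv.swap a b j < i := by
      intro j hj
      rw [Equiv.swap_apply_def]
      split_ifs with h1 h2
      · subst h1; omega
      · subst h2; omega
      · exact hj
    constructor
    · rintro ⟨x, hx, rfl⟩; exact key x hx
    · intro hj; exact ⟨_, key j hj, by simp⟩
  rw [this]
  rfl

theorem opU_left_rename_swap {N : ℕ} {a b : Fin N} (hab : (a : ℕ) + 1 = b) (f : Pol N) :
    opU a (rename (Equiv.swap a b) f) = rename (Equiv.swap a b) (opU b f) + C kap * f := by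
  rw [rename_opU, Equiv.swap_apply_right]
  have hne : a ≠ b := by intro h; subst h; omega
  -- The image exceeds {j < a} by the single index b, and the swap (b a) it contributes undoes the
  -- one already applied: this is the correction term κ f.
  have : (Finset.Iio b).image (Equiv.swap a b) = insert b (Finset.Iio a) := by
    have h1 : Finset.Iio b = insert a (Finset.Iio a) := by
      ext j; simp only [Finset.mem_Iio, Finset.mem_insert]; omega
    rw [h1, Finset.image_insert, Equiv.swap_apply_left]
    congr 1
    ext j
    simp only [Finset.mem_image, Finset.mem_Iio]
    have key : ∀ j, j < a → Equiv.swap a b j = j := fun j hj =>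
      Equiv.swap_apply_of_ne_of_ne hj.ne (by omega)
    constructor
    · rintro ⟨x, hx, rfl⟩; rwa [key x hx]
    · intro hj; exact ⟨j, hj, key j hj⟩
  rw [this, Finset.sum_insert (by simp only [Finset.mem_Iio]; omega), Equiv.swap_comm b a,
    rename_swap_swap]
  unfold opU
  ring

theorem opU_right_rename_swap {N : ℕ} {a b : Fin N} (hab : (a : ℕ) + 1 = b) (f : Pol N) :
    opU b (rename (Equiv.swap a b) f) = rename (Equiv.swap a b) (opU a f) - C kap * f := by
  have h := opU_left_rename_swap hab (rename (Equiv.swap a b) f)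
  rw [rename_swap_swap] at h
  rw [h, map_add, rename_swap_swap, map_mul, rename_C, rename_swap_swap]
  ring

/-- The raising operator `f ↦ x_N θ_N⁻¹ f`. -/
def raise {n : ℕ} (f : Pol (n + 1)) : Pol (n + 1) :=
  X (Fin.last n) * rename (theta (Fin.last n)).symm f

theorem theta_symm_zero {n : ℕ} : (theta (Fin.last n)).symm 0 = Fin.last n := by
  rw [Equiv.symm_apply_eq, theta, Fin.cycleRange_self]

theorem theta_symm_succ {n : ℕ} (i : Fin n) : (theta (Fin.last n)).symm i.succ = i.castSucc := by
  rw [Equiv.symm_apply_eq, theta, Fin.cycleRange_of_lt (Fin.castSucc_lt_last i)]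
  simp

theorem dunkl_last_raise {n : ℕ} (f : Pol (n + 1)) :
    dunkl (Fin.last n) (raise f) = rename (theta (Fin.last n)).symm (opU 0 f) := by
  rw [rename_opU, theta_symm_zero]
  have : Finset.Iio (0 : Fin (n + 1)) = ∅ := by ext j; simp
  simp [this, raise]

theorem opU_last_raise {n : ℕ} (f : Pol (n + 1)) :
    opU (Fin.last n) (raise f) = raise (opU 0 f) + raise f := by
  have h0 : Finset.Ioi (Fin.last n) = ∅ := by ext j; simp [Fin.le_last]
  rw [opU_eq, h0, Finset.sum_empty, mul_zero, add_zero]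
  rw [dunkl_last_raise]
  rfl

/-- The extra swap (N i), present because θ_N⁻¹ carries {j < i + 1} to {N} ∪ {j < i}, is exactly the
commutator of 𝒟_i with x_N. -/
theorem opU_castSucc_raise {n : ℕ} (i : Fin n) (f : Pol (n + 1)) :
    opU i.castSucc (raise f) = raise (opU i.succ f) := by
  have hI : (Finset.Iio i.succ).image (theta (Fin.last n)).symm =
      insert (Fin.last n) (Finset.Iio i.castSucc) := by
    ext j
    simp only [Finset.mem_image, Finset.mem_Iio, Finset.mem_insert]
    constructor
    · rintro ⟨x, hx, rfl⟩
      rcases Fin.eq_zero_or_eq_succ x with rfl | ⟨y, rfl⟩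
      · left; exact theta_symm_zero
      · right; rw [theta_symm_succ]; simpa using hx
    · rintro (rfl | hj)
      · exact ⟨0, by simp, theta_symm_zero⟩
      · have hjl : j ≠ Fin.last n := (hj.trans (Fin.castSucc_lt_last i)).ne
        obtain ⟨y, rfl⟩ := Fin.exists_castSucc_eq.2 hjl
        exact ⟨y.succ, by simpa using hj, theta_symm_succ y⟩
  unfold raise
  rw [rename_opU, theta_symm_succ, hI, Finset.sum_insert (by simp [Fin.le_last])]
  set g := rename (theta (Fin.last n)).symm f with hg
  have hne : i.castSucc ≠ Fin.last n := (Fin.castSucc_lt_last i).ne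
  unfold opU
  rw [mul_left_comm, dunkl_X_mul_of_ne hne, map_mul, rename_X, Equiv.swap_apply_left]
  have : ∀ j ∈ Finset.Iio i.castSucc, rename (Equiv.swap j i.castSucc) (X (Fin.last n) * g) =
      X (Fin.last n) * rename (Equiv.swap j i.castSucc) g := by
    intro j hj
    have hjl : j ≠ Fin.last n := ((Finset.mem_Iio.1 hj).trans (Fin.castSucc_lt_last i)).ne
    rw [map_mul, rename_X, Equiv.swap_apply_of_ne_of_ne hjl.symm hne.symm]
  rw [Finset.sum_congr rfl this, ← Finset.mul_sum, Equiv.swap_comm (Fin.last n)]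
  ring

/-! ### The order on compositions -/

theorem plus_eq_comp {N : ℕ} (α : Fin N →₀ ℕ) :
    plus α = ⇑α ∘ ⇑(Fin.revPerm.trans (Tuple.sort (⇑α))) := rfl

theorem plus_equivMapDomain {N : ℕ} (w : Equiv.Perm (Fin N)) (α : Fin N →₀ ℕ) :
    plus (α.equivMapDomain w) = plus α := by
  have h := Tuple.comp_perm_comp_sort_eq_comp_sort (f := ⇑α) (σ := w.symm)
  funext i
  exact congrFun h (Fin.rev i)

theorem sum_comp_plus {N : ℕ} (g : ℕ → ℕ) (α : Fin N →₀ ℕ) :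
    ∑ i, g (plus α i) = ∑ i, g (α i) := by
  rw [plus_eq_comp]
  exact Equiv.sum_comp (Fin.revPerm.trans (Tuple.sort (⇑α))) fun i => g (α i)

/-- Exchange argument: the indices of S beyond j carry values at most f j, and are as many as the
indices up to j missing from S, whose values are at least f j. -/
theorem sum_le_sum_Iic_of_antitone {N : ℕ} {f : Fin N → ℕ} (hf : Antitone f) (j : Fin N)
    (S : Finset (Fin N)) (hS : S.card = (j : ℕ) + 1) :
    ∑ i ∈ S, f i ≤ ∑ i ∈ Finset.Iic j, f i := by
  have hI : (Finset.Iic j).card = (j : ℕ) + 1 := Fin.card_Iic j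
  have h1 := Finset.card_sdiff_add_card_inter S (Finset.Iic j)
  have h2 := Finset.card_sdiff_add_card_inter (Finset.Iic j) S
  rw [Finset.inter_comm] at h2
  have hc : (S \ Finset.Iic j).card = (Finset.Iic j \ S).card := by omega
  rw [← Finset.sum_inter_add_sum_sdiff S (Finset.Iic j),
    ← Finset.sum_inter_add_sum_sdiff (Finset.Iic j) S, Finset.inter_comm]
  refine Nat.add_le_add_left ?_ _
  calc ∑ i ∈ S \ Finset.Iic j, f i ≤ (S \ Finset.Iic j).card • f j := by
        refine Finset.sum_le_card_nsmul _ _ _ fun x hx => hf ?_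
        simp only [Finset.mem_sdiff, Finset.mem_Iic] at hx
        exact (not_le.1 hx.2).le
    _ = (Finset.Iic j \ S).card • f j := by rw [hc]
    _ ≤ ∑ i ∈ Finset.Iic j \ S, f i := by
        refine Finset.card_nsmul_le_sum _ _ _ fun x hx => hf ?_
        simp only [Finset.mem_sdiff, Finset.mem_Iic] at hx
        exact hx.1

theorem sum_le_sum_Iic_plus {N : ℕ} (α : Fin N →₀ ℕ) (j : Fin N) (S : Finset (Fin N))
    (hS : S.card = (j : ℕ) + 1) : ∑ i ∈ S, α i ≤ ∑ i ∈ Finset.Iic j, plus α i := by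
  set σ := Fin.revPerm.trans (Tuple.sort (⇑α)) with hσ
  have h := sum_le_sum_Iic_of_antitone (plus_antitone α) j (S.map σ.symm.toEmbedding)
    (by rw [Finset.card_map, hS])
  rw [Finset.sum_map] at h
  simpa [plus_eq_comp, ← hσ] using h

theorem exists_sum_eq_sum_Iic_plus {N : ℕ} (α : Fin N →₀ ℕ) (j : Fin N) :
    ∃ S : Finset (Fin N), S.card = (j : ℕ) + 1 ∧
      ∑ i ∈ Finset.Iic j, plus α i = ∑ i ∈ S, α i := by
  refine ⟨(Finset.Iic j).map (Fin.revPerm.trans (Tuple.sort (⇑α))).toEmbedding, ?_, ?_⟩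
  · rw [Finset.card_map, Fin.card_Iic]
  · rw [Finset.sum_map]
    rfl

theorem eq_of_sum_Iic_eq {N : ℕ} {a b : Fin N → ℕ}
    (h : ∀ j : Fin N, ∑ i ∈ Finset.Iic j, a i = ∑ i ∈ Finset.Iic j, b i) : a = b := by
  funext j
  induction j using WellFoundedLT.induction with
  | _ j ih =>
    have hj := h j
    have hI : Finset.Iic j = insert j (Finset.Iio j) := by
      ext x; simp [le_iff_eq_or_lt]
    have h0 : j ∉ Finset.Iio j := by simp
    have hs : ∑ i ∈ Finset.Iio j, a i = ∑ i ∈ Finset.Iio j, b i :=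
      Finset.sum_congr rfl fun x hx => ih x (Finset.mem_Iio.1 hx)
    rw [hI, Finset.sum_insert h0, Finset.sum_insert h0, hs] at hj
    exact Nat.add_right_cancel hj

theorem Dominates.trans {N : ℕ} {a b c : Fin N → ℕ} (h : Dominates a b) (h' : Dominates b c) :
    Dominates a c := by
  refine ⟨?_, fun j => (h'.2 j).trans (h.2 j)⟩
  rintro rfl
  exact h.1 (eq_of_sum_Iic_eq fun j => le_antisymm (h'.2 j) (h.2 j))

theorem TriGT.trans {N : ℕ} {α β γ : Fin N →₀ ℕ} (h : TriGT α β) (h' : TriGT β γ) :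
    TriGT α γ := by
  refine ⟨h.1.trans h'.1, ?_⟩
  rcases h.2 with h1 | ⟨h1, h2⟩ <;> rcases h'.2 with h3 | ⟨h3, h4⟩
  · exact Or.inl (h1.trans h3)
  · exact Or.inl (h3 ▸ h1)
  · exact Or.inl (h1 ▸ h3)
  · exact Or.inr ⟨h1.trans h3, h2.trans h4⟩

theorem not_triGT_self {N : ℕ} (α : Fin N →₀ ℕ) : ¬ TriGT α α := by
  rintro ⟨-, h | ⟨-, h⟩⟩ <;> exact h.1 rfl

theorem not_triGT_zero {N : ℕ} (β : Fin N →₀ ℕ) : ¬ TriGT 0 β := by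
  intro h
  have hβ : β = 0 := by
    ext i
    have h1 := h.1
    simp only [Finsupp.coe_zero, Pi.zero_apply, Finset.sum_const_zero] at h1
    exact Finset.sum_eq_zero_iff.1 h1.symm i (Finset.mem_univ i)
  exact not_triGT_self 0 (hβ ▸ h)

theorem sum_eq_add_add_sum_erase {N : ℕ} {i j : Fin N} (hij : i ≠ j) (S : Finset (Fin N))
    (f : Fin N → ℕ) : ∑ x ∈ S, f x = (if i ∈ S then f i else 0) + (if j ∈ S then f j else 0) +
      ∑ x ∈ (S.erase i).erase j, f x := by
  by_cases hj : j ∈ S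
  · have hj' : j ∈ S.erase i := Finset.mem_erase.2 ⟨hij.symm, hj⟩
    rw [if_pos hj, add_assoc, Finset.add_sum_erase _ f hj']
    by_cases hi : i ∈ S
    · rw [if_pos hi, Finset.add_sum_erase _ f hi]
    · rw [if_neg hi, Finset.erase_eq_of_notMem hi, zero_add]
  · have hj' : j ∉ S.erase i := fun h => hj (Finset.mem_of_mem_erase h)
    rw [if_neg hj, add_zero, Finset.erase_eq_of_notMem hj']
    by_cases hi : i ∈ S
    · rw [if_pos hi, Finset.add_sum_erase _ f hi]
    · rw [if_neg hi, Finset.erase_eq_of_notMem hi, zero_add]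

/-- Moving two entries strictly inside the interval that they span lowers a composition. -/
theorem triGT_of_between {N : ℕ} {α β : Fin N →₀ ℕ} {i j : Fin N} (hij : i ≠ j)
    (hoff : ∀ x, x ≠ i → x ≠ j → β x = α x) (hsum : β i + β j = α i + α j)
    (hi : β i < α i) (hj : β j < α i) : TriGT α β := by
  have hrest : ∀ (S : Finset (Fin N)) (g : ℕ → ℕ),
      ∑ x ∈ (S.erase i).erase j, g (β x) = ∑ x ∈ (S.erase i).erase j, g (α x) := by
    intro S g
    refine Finset.sum_congr rfl fun x hx => ?_
    simp only [Finset.mem_erase] at hx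
    rw [hoff x hx.2.1 hx.1]
  refine ⟨?_, Or.inl ⟨?_, ?_⟩⟩
  · rw [sum_eq_add_add_sum_erase hij _ α, sum_eq_add_add_sum_erase hij _ β]
    have := hrest Finset.univ id
    simp only [id] at this
    simp only [Finset.mem_univ, if_true, this, hsum]
  -- Strict convexity: moving both entries inside the interval lowers the sum of squares, which
  -- depends only on the rearrangement.
  · intro h
    have h1 := sum_comp_plus (fun n => n ^ 2) α
    rw [h, sum_comp_plus (fun n => n ^ 2) β, sum_eq_add_add_sum_erase hij,
      sum_eq_add_add_sum_erase hij _ fun x => α x ^ 2, hrest Finset.univ fun n => n ^ 2] at h1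
    simp only [Finset.mem_univ, if_true, add_left_inj] at h1
    zify at h1 hsum hi hj
    nlinarith [mul_pos (sub_pos.2 hi) (sub_pos.2 hj)]
  · intro m
    obtain ⟨S, hS, hSsum⟩ := exists_sum_eq_sum_Iic_plus β m
    rw [hSsum]
    have hr := hrest S id
    simp only [id] at hr
    by_cases hiS : i ∈ S
    · refine le_trans ?_ (sum_le_sum_Iic_plus α m S hS)
      rw [sum_eq_add_add_sum_erase hij _ α, sum_eq_add_add_sum_erase hij _ β, hr]
      refine Nat.add_le_add_right ?_ _
      by_cases hjS : j ∈ S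
      · simp only [hiS, hjS, if_true, hsum, le_refl]
      · simp only [hiS, hjS, if_true, if_false]; omega
    · by_cases hjS : j ∈ S
      · have hi' : i ∉ S.erase j := fun h => hiS (Finset.mem_of_mem_erase h)
        refine le_trans ?_ (sum_le_sum_Iic_plus α m (insert i (S.erase j)) ?_)
        · rw [Finset.sum_insert hi', sum_eq_add_add_sum_erase hij _ β, hr,
            Finset.erase_eq_of_notMem hiS]
          refine Nat.add_le_add_right ?_ _
          simp only [hiS, hjS, if_true, if_false]; omega
        · rw [Finset.card_insert_of_notMem hi', Finset.card_erase_add_one hjS, hS]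
      · refine le_trans ?_ (sum_le_sum_Iic_plus α m S hS)
        rw [sum_eq_add_add_sum_erase hij _ α, sum_eq_add_add_sum_erase hij _ β, hr]
        simp [hiS, hjS]

theorem sum_equivMapDomain {N : ℕ} (w : Equiv.Perm (Fin N)) (α : Fin N →₀ ℕ) :
    ∑ i, α.equivMapDomain w i = ∑ i, α i :=
  Equiv.sum_comp w.symm α

/-- Moving a larger entry to the right lowers a composition. -/
theorem triGT_swap {N : ℕ} (α : Fin N →₀ ℕ) {a b : Fin N} (hab : a < b) (h : α b < α a) :
    TriGT α (α.equivMapDomain (Equiv.swap a b)) := by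
  refine ⟨(sum_equivMapDomain _ _).symm, Or.inr ⟨(plus_equivMapDomain _ _).symm, ?_, ?_⟩⟩
  · intro e
    have := congrFun e a
    simp only [Finsupp.equivMapDomain_apply, Equiv.symm_swap, Equiv.swap_apply_left] at this
    omega
  · intro m
    rw [sum_eq_add_add_sum_erase hab.ne _ α, sum_eq_add_add_sum_erase hab.ne _ (α.equivMapDomain _)]
    refine Nat.add_le_add ?_ (Finset.sum_le_sum fun x hx => ?_)
    · simp only [Finset.mem_Iic, Finsupp.equivMapDomain_apply, Equiv.symm_swap,
        Equiv.swap_apply_left, Equiv.swap_apply_right]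
      by_cases hb : b ≤ m
      · simp only [hb, hab.le.trans hb, if_true]; omega
      · simp only [hb, if_false]
        split_ifs <;> omega
    · simp only [Finset.mem_erase] at hx
      simp only [Finsupp.equivMapDomain_apply, Equiv.symm_swap,
        Equiv.swap_apply_of_ne_of_ne hx.2.1 hx.1, le_refl]

/-- Every member of a finite set of compositions lies weakly below a maximal one. -/
theorem exists_maximal {N : ℕ} (S : Finset (Fin N →₀ ℕ)) {β : Fin N →₀ ℕ} (hβ : β ∈ S) :
    ∃ γ ∈ S, (γ = β ∨ TriGT γ β) ∧ ∀ δ ∈ S, ¬ TriGT δ γ := by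
  have : IsStrictOrder (Fin N →₀ ℕ) TriGT :=
    { irrefl := not_triGT_self, trans := fun _ _ _ h h' => TriGT.trans h h' }
  have wf := S.wellFoundedOn (r := TriGT)
  refine wf.induction (P := fun β => ∃ γ ∈ S, (γ = β ∨ TriGT γ β) ∧ ∀ δ ∈ S, ¬ TriGT δ γ) hβ
    fun β hβ ih => ?_
  by_cases h : ∃ δ ∈ S, TriGT δ β
  · obtain ⟨δ, hδ, hδβ⟩ := h
    obtain ⟨γ, hγ, h1, h2⟩ := ih δ hδ hδβ
    refine ⟨γ, hγ, Or.inr ?_, h2⟩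
    rcases h1 with rfl | h1
    · exact hδβ
    · exact h1.trans hδβ
  · push Not at h
    exact ⟨β, hβ, Or.inl rfl, h⟩

/-! ### Triangularity of the operators `𝒰_i` -/

/-- The span of the monomials strictly below `x^γ`. -/
def lower {N : ℕ} (γ : Fin N →₀ ℕ) : Submodule K (Pol N) := restrictSupport K {β | TriGT γ β}

theorem monomial_mem_lower {N : ℕ} {γ β : Fin N →₀ ℕ} (h : TriGT γ β) (c : K) :
    monomial β c ∈ lower γ :=
  (monomial_mem_restrictSupport K).2 (Or.inl h)

theorem coeff_eq_zero_of_mem_lower {N : ℕ} {γ β : Fin N →₀ ℕ} {p : Pol N} (hp : p ∈ lower γ)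
    (h : ¬ TriGT γ β) : coeff β p = 0 := by
  by_contra hc
  exact h ((mem_restrictSupport_iff K).1 hp (mem_support_iff.2 hc))

theorem rename_monomial_perm {N : ℕ} (w : Equiv.Perm (Fin N)) (γ : Fin N →₀ ℕ) (c : K) :
    rename w (monomial γ c) = monomial (γ.equivMapDomain w) c := by
  rw [rename_monomial, Finsupp.equivMapDomain_eq_mapDomain]

theorem coeff_rename_perm {N : ℕ} (w : Equiv.Perm (Fin N)) (γ : Fin N →₀ ℕ) (f : Pol N) :
    coeff (γ.equivMapDomain w) (rename w f) = coeff γ f := by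
  rw [Finsupp.equivMapDomain_eq_mapDomain, coeff_rename_mapDomain _ w.injective]

theorem rename_swap_monomial_of_eq {N : ℕ} {i j : Fin N} {δ : Fin N →₀ ℕ} (h : δ i = δ j) :
    rename (Equiv.swap i j) (monomial δ (1 : K)) = monomial δ 1 := by
  rw [rename_monomial_perm]
  refine congrArg (fun e => monomial e (1 : K)) (Finsupp.ext fun x => ?_)
  rw [Finsupp.equivMapDomain_apply, Equiv.symm_swap, Equiv.swap_apply_def]
  split_ifs with h1 h2
  · rw [h1, h]
  · rw [h2, h]
  · rfl

theorem divDiff_monomial_mul_pow_left {N : ℕ} {i j : Fin N} (hij : i ≠ j) {δ : Fin N →₀ ℕ}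
    (h : δ i = δ j) (d : ℕ) : divDiff i j (monomial δ 1 * X i ^ d) =
      monomial δ 1 * ∑ t ∈ Finset.range d, X i ^ t * X j ^ (d - 1 - t) := by
  refine divDiff_eq hij ?_
  rw [mul_left_comm, (Commute.all (X i) (X j : Pol N)).mul_geom_sum₂, map_mul,
    rename_swap_monomial_of_eq h, map_pow, rename_X, Equiv.swap_apply_left]
  ring

theorem divDiff_monomial_mul_pow_right {N : ℕ} {i j : Fin N} (hij : i ≠ j) {δ : Fin N →₀ ℕ}
    (h : δ i = δ j) (d : ℕ) : divDiff i j (monomial δ 1 * X j ^ d) =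
      -(monomial δ 1 * ∑ t ∈ Finset.range d, X i ^ t * X j ^ (d - 1 - t)) := by
  refine divDiff_eq hij ?_
  rw [mul_neg, mul_left_comm, (Commute.all (X i) (X j : Pol N)).mul_geom_sum₂, map_mul,
    rename_swap_monomial_of_eq h, map_pow, rename_X, Equiv.swap_apply_right]
  ring

theorem X_mul_monomial_mul_geom_sum {N : ℕ} (i j : Fin N) (δ : Fin N →₀ ℕ) (d : ℕ) :
    (X i * (monomial δ 1 * ∑ t ∈ Finset.range d, X i ^ t * X j ^ (d - 1 - t)) : Pol N) =
      ∑ t ∈ Finset.range d,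
        monomial (δ + (Finsupp.single i (t + 1) + Finsupp.single j (d - 1 - t))) 1 := by
  rw [Finset.mul_sum, Finset.mul_sum]
  refine Finset.sum_congr rfl fun t _ => ?_
  have : (monomial (δ + (Finsupp.single i (t + 1) + Finsupp.single j (d - 1 - t))) 1 : Pol N) =
      monomial δ 1 * (X i ^ (t + 1) * X j ^ (d - 1 - t)) := by
    simp only [X_pow_eq_monomial, monomial_mul, mul_one]
  rw [this]
  ring

theorem exists_balanced {N : ℕ} {i j : Fin N} (hij : i ≠ j) {γ : Fin N →₀ ℕ} (h : γ j < γ i) :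
    ∃ (δ : Fin N →₀ ℕ) (d : ℕ), δ i = δ j ∧ γ = δ + Finsupp.single i (d + 1) := by
  refine ⟨γ - Finsupp.single i (γ i - γ j), γ i - γ j - 1, ?_, ?_⟩
  · simp [hij]; omega
  · rw [show γ i - γ j - 1 + 1 = γ i - γ j by omega, tsub_add_cancel_of_le]
    rw [Finsupp.single_le_iff]
    omega

/-- With γ = δ + (d+1)ε_i and δ_i = δ_j, the factor x^δ is (i j)-invariant and the divided
difference becomes a geometric sum. After multiplication by x_i its top term is x^γ; every other
term has its exponents at i and j below γ_i, with the same sum. -/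
theorem X_mul_divDiff_sub_mem_lower {N : ℕ} {i j : Fin N} (hij : i ≠ j) {γ : Fin N →₀ ℕ}
    (h : γ j < γ i) : X i * divDiff i j (monomial γ 1) - monomial γ 1 ∈ lower γ := by
  obtain ⟨δ, d, hδ, rfl⟩ := exists_balanced hij h
  have e : (monomial (δ + Finsupp.single i (d + 1)) 1 : Pol N) = monomial δ 1 * X i ^ (d + 1) := by
    rw [X_pow_eq_monomial, monomial_mul, mul_one]
  rw [e, divDiff_monomial_mul_pow_left hij hδ, X_mul_monomial_mul_geom_sum, ← e,
    Finset.sum_range_succ]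
  simp only [add_tsub_cancel_right, tsub_self, Finsupp.single_zero, add_zero,
    add_sub_cancel_right]
  refine Submodule.sum_mem _ fun t ht => monomial_mem_lower ?_ _
  have ht' := Finset.mem_range.1 ht
  refine triGT_of_between hij ?_ ?_ ?_ ?_
  · intro x hi hj
    simp [hi, hj]
  all_goals simp [hij, hij.symm]
  all_goals omega

/-- The same geometric sum with opposite sign; its top term is now the swapped monomial, cancelled
by the added summand. -/
theorem X_mul_divDiff_add_mem_lower {N : ℕ} {i j : Fin N} (hij : i ≠ j) {γ : Fin N →₀ ℕ}
    (h : γ i < γ j) :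
    X i * divDiff i j (monomial γ 1) + rename (Equiv.swap i j) (monomial γ 1) ∈ lower γ := by
  obtain ⟨δ, d, hδ, rfl⟩ := exists_balanced hij.symm h
  have e (m : Fin N) :
      (monomial (δ + Finsupp.single m (d + 1)) 1 : Pol N) = monomial δ 1 * X m ^ (d + 1) := by
    rw [X_pow_eq_monomial, monomial_mul, mul_one]
  have e' : rename (Equiv.swap i j) (monomial (δ + Finsupp.single j (d + 1)) 1 : Pol N) =
      monomial (δ + Finsupp.single i (d + 1)) 1 := by
    rw [e, e, map_mul, rename_swap_monomial_of_eq hδ.symm, map_pow, rename_X,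
      Equiv.swap_apply_right]
  rw [e', e j, divDiff_monomial_mul_pow_right hij hδ.symm, mul_neg, X_mul_monomial_mul_geom_sum,
    Finset.sum_range_succ]
  simp only [add_tsub_cancel_right, tsub_self, Finsupp.single_zero, add_zero, neg_add,
    neg_add_cancel_right]
  refine Submodule.neg_mem _ (Submodule.sum_mem _ fun t ht => monomial_mem_lower ?_ _)
  have ht' := Finset.mem_range.1 ht
  refine triGT_of_between hij.symm ?_ ?_ ?_ ?_
  · intro x hj hi
    simp [hi, hj]
  all_goals simp [hij, hij.symm]
  all_goals omega

theorem divDiff_monomial_of_eq {N : ℕ} {i j : Fin N} (hij : i ≠ j) {γ : Fin N →₀ ℕ}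
    (h : γ i = γ j) : divDiff i j (monomial γ 1) = 0 :=
  divDiff_eq hij (by rw [rename_swap_monomial_of_eq h, sub_self, mul_zero])

/-- The contribution of a single j to the κ-part of 𝒰_i. The 0/1 diagonal coefficient is the
indicator of the j not counted by r(γ, i), so summing over j produces N - r(γ, i). -/
theorem X_mul_divDiff_add_ite_sub_mem_lower {N : ℕ} {i j : Fin N} (hij : i ≠ j)
    (γ : Fin N →₀ ℕ) :
    X i * divDiff i j (monomial γ 1) +
        (if i < j then rename (Equiv.swap i j) (monomial γ 1) else 0) -
        C (if γ j < γ i ∨ (γ j = γ i ∧ i < j) then (1 : K) else 0) * monomial γ 1 ∈ lower γ := by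
  rcases lt_trichotomy (γ j) (γ i) with h | h | h
  · have h1 := X_mul_divDiff_sub_mem_lower hij h
    rw [if_pos (Or.inl h), C_1, one_mul, add_sub_right_comm]
    refine Submodule.add_mem _ h1 ?_
    split_ifs with hlt
    · rw [rename_monomial_perm]
      exact monomial_mem_lower (triGT_swap γ hlt h) _
    · exact Submodule.zero_mem _
  · rw [divDiff_monomial_of_eq hij h.symm, rename_swap_monomial_of_eq h.symm]
    by_cases hlt : i < j <;> simp [h, hlt]
  · have h1 := X_mul_divDiff_add_mem_lower hij h
    have h2 : ¬ (γ j < γ i ∨ (γ j = γ i ∧ i < j)) := by omega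
    rw [if_neg h2, C_0, zero_mul, sub_zero]
    split_ifs with hlt
    · exact h1
    · rw [add_zero]
      rw [← add_sub_cancel_right (X i * _) (rename (Equiv.swap i j) (monomial γ (1 : K)))]
      refine Submodule.sub_mem _ h1 ?_
      rw [rename_monomial_perm, Equiv.swap_comm]
      exact monomial_mem_lower (triGT_swap γ (lt_of_le_of_ne (not_lt.1 hlt) hij.symm) h) _

theorem rank_add_card {N : ℕ} (γ : Fin N →₀ ℕ) (i : Fin N) :
    rank γ i + (Finset.univ.filter fun j => γ j < γ i ∨ (γ j = γ i ∧ i < j)).card = N := by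
  unfold rank
  rw [Finset.card_filter, Finset.card_filter, Finset.card_filter, ← Finset.sum_add_distrib,
    ← Finset.sum_add_distrib]
  have : ∀ j : Fin N, ((if γ i < γ j then 1 else 0) + (if j ≤ i ∧ γ j = γ i then 1 else 0)) +
      (if γ j < γ i ∨ (γ j = γ i ∧ i < j) then 1 else 0) = 1 := by
    intro j
    split_ifs <;> first | rfl | omega
  simp only [this, Finset.sum_const, Finset.card_univ, Fintype.card_fin, smul_eq_mul, mul_one]

theorem opU_monomial_sub_mem_lower {N : ℕ} (i : Fin N) (γ : Fin N →₀ ℕ) :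
    opU i (monomial γ 1) - C (xi γ i) * monomial γ 1 ∈ lower γ := by
  have hxi : xi γ i = kap * ∑ j ∈ Finset.univ.erase i,
      (if γ j < γ i ∨ (γ j = γ i ∧ i < j) then (1 : K) else 0) + (γ i : K) + 1 := by
    have h1 : (N : K) - (rank γ i : K) =
        ((Finset.univ.filter fun j => γ j < γ i ∨ (γ j = γ i ∧ i < j)).card : K) := by
      rw [sub_eq_iff_eq_add']
      exact_mod_cast (rank_add_card γ i).symm
    unfold xi
    rw [h1, Finset.sum_erase _ (by simp), Finset.sum_boole]
    ring
  have hsum : ∑ j ∈ Finset.Ioi i, rename (Equiv.swap i j) (monomial γ (1 : K)) =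
      ∑ j ∈ Finset.univ.erase i,
        (if i < j then rename (Equiv.swap i j) (monomial γ (1 : K)) else 0) := by
    rw [Finset.sum_erase _ (by simp), ← Finset.sum_filter]
    congr 1
    ext j
    simp
  have hd : (X i * pderiv i (monomial γ 1) : Pol N) = C (γ i : K) * monomial γ 1 := by
    rw [X_mul_pderiv_monomial, nsmul_eq_mul, map_natCast]
  have key : opU i (monomial γ 1) - C (xi γ i) * monomial γ 1 =
      kap • ∑ j ∈ Finset.univ.erase i, (X i * divDiff i j (monomial γ 1) +
        (if i < j then rename (Equiv.swap i j) (monomial γ 1) else 0) -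
        C (if γ j < γ i ∨ (γ j = γ i ∧ i < j) then (1 : K) else 0) * monomial γ 1) := by
    rw [opU_eq, hsum, hxi, Finset.sum_sub_distrib, Finset.sum_add_distrib, ← Finset.mul_sum,
      ← Finset.sum_mul, ← map_sum, smul_eq_C_mul]
    unfold dunkl
    simp only [mul_add, hd, map_add, map_mul, map_one]
    ring
  rw [key]
  exact Submodule.smul_mem _ _ (Submodule.sum_mem _ fun j hj =>
    X_mul_divDiff_add_ite_sub_mem_lower (Finset.ne_of_mem_erase hj).symm γ)

theorem coeff_opU_monomial {N : ℕ} (i : Fin N) {β γ : Fin N →₀ ℕ} (h : ¬ TriGT γ β) :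
    coeff β (opU i (monomial γ 1)) = xi β i * coeff β (monomial γ (1 : K)) := by
  have h1 := coeff_eq_zero_of_mem_lower (opU_monomial_sub_mem_lower i γ) h
  rw [coeff_sub, coeff_C_mul, sub_eq_zero] at h1
  rw [h1, coeff_monomial]
  split_ifs with e
  · rw [e]
  · simp

/-- On a maximal exponent of `f` the operator `𝒰_i` acts diagonally. -/
theorem coeff_opU {N : ℕ} (i : Fin N) {β : Fin N →₀ ℕ} {f : Pol N}
    (h : ∀ γ, coeff γ f ≠ 0 → ¬ TriGT γ β) : coeff β (opU i f) = xi β i * coeff β f := by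
  let U : Pol N →ₗ[K] Pol N :=
    { toFun := opU i
      map_add' := opU_add i
      map_smul' := fun c g => by
        rw [smul_eq_C_mul, smul_eq_C_mul, opU_C_mul]; rfl }
  have hf : opU i f = ∑ γ ∈ f.support, C (coeff γ f) * opU i (monomial γ 1) := by
    calc opU i f = U (∑ γ ∈ f.support, monomial γ (coeff γ f)) := by
          rw [← f.as_sum]; rfl
      _ = _ := by
          rw [map_sum]
          refine Finset.sum_congr rfl fun γ _ => ?_
          rw [← opU_C_mul, C_mul_monomial, mul_one]
          rfl
  rw [hf, coeff_sum]
  conv_rhs => rw [f.as_sum, coeff_sum, Finset.mul_sum]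
  refine Finset.sum_congr rfl fun γ hγ => ?_
  rw [coeff_C_mul, coeff_opU_monomial i (h γ (mem_support_iff.1 hγ)), mul_left_comm, ← coeff_C_mul,
    C_mul_monomial, mul_one]

/-! ### Spectral vectors and joint eigenvectors -/

/-- The parameter κ is transcendental over ℚ, so a spectral value reveals both the rank and the
entry. -/
theorem eq_zero_of_mul_kap_add_eq_zero {a b : ℤ} (h : (a : K) * kap + (b : K) = 0) :
    a = 0 ∧ b = 0 := by
  have h1 : algebraMap (Polynomial ℚ) K
      (Polynomial.C (a : ℚ) * Polynomial.X + Polynomial.C (b : ℚ)) = algebraMap _ _ 0 := by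
    simpa [kap, RatFunc.algebraMap_X] using h
  have h2 := RatFunc.algebraMap_injective ℚ h1
  have hX := congrArg (fun p => Polynomial.coeff p 1) h2
  have h0 := congrArg (fun p => Polynomial.coeff p 0) h2
  simp only [Polynomial.coeff_add, Polynomial.coeff_C_mul, Polynomial.coeff_X,
    Polynomial.coeff_C] at hX h0
  norm_num at hX h0
  exact ⟨hX, h0⟩

theorem mul_kap_add_ne_zero (a : ℤ) {b : ℤ} (hb : b ≠ 0) : (a : K) * kap + (b : K) ≠ 0 :=
  fun h => hb (eq_zero_of_mul_kap_add_eq_zero h).2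

theorem rank_eq_and_eq_of_xi_eq {N : ℕ} {α β : Fin N →₀ ℕ} {i j : Fin N}
    (h : xi α i = xi β j) : rank α i = rank β j ∧ α i = β j := by
  have h1 : (((rank β j : ℤ) - rank α i : ℤ) : K) * kap + (((α i : ℤ) - β j : ℤ) : K) = 0 := by
    unfold xi at h
    push_cast
    linear_combination h
  obtain ⟨h2, h3⟩ := eq_zero_of_mul_kap_add_eq_zero h1
  omega

theorem eq_of_xi_eq {N : ℕ} {α β : Fin N →₀ ℕ} (h : ∀ i, xi α i = xi β i) : α = β :=
  Finsupp.ext fun i => (rank_eq_and_eq_of_xi_eq (h i)).2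

/-- Above each exponent of a joint eigenvector there is one that carries its spectrum. -/
theorem exists_xi_eq_of_eigenvector {N : ℕ} {c : Fin N → K} {f : Pol N}
    (h : ∀ i, opU i f = C (c i) * f) {β : Fin N →₀ ℕ} (hβ : coeff β f ≠ 0) :
    ∃ γ, coeff γ f ≠ 0 ∧ (γ = β ∨ TriGT γ β) ∧ ∀ i, c i = xi γ i := by
  obtain ⟨γ, hγ, h1, h2⟩ := exists_maximal f.support (mem_support_iff.2 hβ)
  refine ⟨γ, mem_support_iff.1 hγ, h1, fun i => ?_⟩
  have h3 := coeff_opU i (β := γ) (f := f) fun δ hδ => h2 δ (mem_support_iff.2 hδ)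
  rw [h i, coeff_C_mul] at h3
  exact mul_right_cancel₀ (mem_support_iff.1 hγ) h3

/-- Triangular shape is automatic: a maximal exponent above β carries the spectrum ξ(α), hence
equals α. -/
theorem isNSJack_of_eigenvector {N : ℕ} {α : Fin N →₀ ℕ} {f : Pol N}
    (h : ∀ i, opU i f = C (xi α i) * f) (h1 : coeff α f = 1) : IsNSJack α f := by
  refine ⟨h, h1, fun β hβ => ?_⟩
  obtain ⟨γ, -, hγ, he⟩ := exists_xi_eq_of_eigenvector h hβ
  rw [eq_of_xi_eq he]
  exact hγ.imp_left Eq.symm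

/-- A nonzero difference would be a joint eigenvector of spectrum ξ(α), hence contain x^α, whose
coefficient cancels by monicity. -/
theorem IsNSJack.unique {N : ℕ} {α : Fin N →₀ ℕ} {f g : Pol N} (hf : IsNSJack α f)
    (hg : IsNSJack α g) : f = g := by
  by_contra hne
  obtain ⟨β, hβ⟩ := ne_zero_iff.1 (sub_ne_zero.2 hne)
  have he : ∀ i, opU i (f - g) = C (xi α i) * (f - g) := by
    intro i
    have : f - g = f + C (-1) * g := by simp [sub_eq_add_neg]
    rw [this, opU_add, opU_C_mul, hf.1, hg.1]
    ring
  obtain ⟨γ, hγ, -, h⟩ := exists_xi_eq_of_eigenvector he hβ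
  rw [← eq_of_xi_eq h, coeff_sub, hf.2.1, hg.2.1, sub_self] at hγ
  exact hγ rfl

/-! ### Ranks, spectra and eigenvectors under the two moves on labels. -/

theorem rank_eq_card {N : ℕ} (α : Fin N →₀ ℕ) (i : Fin N) :
    rank α i = (Finset.univ.filter fun j => α i < α j ∨ (j ≤ i ∧ α j = α i)).card := by
  unfold rank
  rw [Finset.filter_or, Finset.card_union_of_disjoint]
  rw [Finset.disjoint_filter]
  intro j _ h1 h2
  omega

theorem rank_eq_rank_of_iff {N : ℕ} {α β : Fin N →₀ ℕ} (w : Equiv.Perm (Fin N)) (i : Fin N)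
    (h : ∀ j, (β (w i) < β (w j) ∨ (w j ≤ w i ∧ β (w j) = β (w i))) ↔
      (α i < α j ∨ (j ≤ i ∧ α j = α i))) : rank β (w i) = rank α i := by
  rw [rank_eq_card, rank_eq_card]
  symm
  refine Finset.card_bij (fun j _ => w j) ?_ ?_ ?_
  · intro j hj
    simpa [h j] using hj
  · intro j _ j' _ e
    exact w.injective e
  · intro j hj
    refine ⟨w.symm j, ?_, by simp⟩
    simpa [← h (w.symm j)] using hj

theorem equivMapDomain_swap_apply {N : ℕ} (a b i : Fin N) (α : Fin N →₀ ℕ) :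
    α.equivMapDomain (Equiv.swap a b) i = α (Equiv.swap a b i) := rfl

theorem equivMapDomain_swap_swap {N : ℕ} (a b : Fin N) (α : Fin N →₀ ℕ) :
    (α.equivMapDomain (Equiv.swap a b)).equivMapDomain (Equiv.swap a b) = α := by
  ext i
  simp

/-- An adjacent swap changes the relative order of positions only for the pair a, b, and position
order matters only for ties. -/
theorem rank_swap {N : ℕ} {α : Fin N →₀ ℕ} {a b : Fin N} (hab : (a : ℕ) + 1 = b)
    (h : α a ≠ α b) (i : Fin N) :
    rank (α.equivMapDomain (Equiv.swap a b)) (Equiv.swap a b i) = rank α i := by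
  refine rank_eq_rank_of_iff _ _ fun j => ?_
  simp only [equivMapDomain_swap_apply, Equiv.swap_apply_self]
  refine or_congr_right (and_congr_left fun e => ?_)
  rw [Equiv.swap_apply_def, Equiv.swap_apply_def]
  split_ifs with h1 h2 h3 h4 h5 h6 <;> subst_vars <;> omega

theorem xi_swap {N : ℕ} {α : Fin N →₀ ℕ} {a b : Fin N} (hab : (a : ℕ) + 1 = b)
    (h : α a ≠ α b) (i : Fin N) :
    xi (α.equivMapDomain (Equiv.swap a b)) (Equiv.swap a b i) = xi α i := by
  unfold xi
  rw [rank_swap hab h, equivMapDomain_swap_apply, Equiv.swap_apply_self]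

/-- The intertwining step from `α` to the adjacent transposition of `α`. -/
theorem IsNSJack.swap {N : ℕ} {α : Fin N →₀ ℕ} {a b : Fin N} (hab : (a : ℕ) + 1 = b)
    (h : α a < α b) {g : Pol N} (hg : IsNSJack α g) :
    IsNSJack (α.equivMapDomain (Equiv.swap a b))
      (rename (Equiv.swap a b) g + C (kap / (xi α b - xi α a)) * g) := by
  have hne : xi α b - xi α a ≠ 0 :=
    sub_ne_zero.2 fun e => h.ne' (rank_eq_and_eq_of_xi_eq e).2
  set c := kap / (xi α b - xi α a) with hc
  -- The scalar c is chosen so that the term ±κ g from moving the swap past 𝒰_a or 𝒰_b is absorbed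
  -- by the change of eigenvalue on c g.
  have hcx : c * (xi α b - xi α a) = kap := div_mul_cancel₀ _ hne
  have hx := xi_swap hab h.ne
  refine isNSJack_of_eigenvector (fun i => ?_) ?_
  · rw [opU_add, opU_C_mul, hg.1 i]
    by_cases ha : i = a
    · subst ha
      have h1 := hx b
      rw [Equiv.swap_apply_right] at h1
      rw [opU_left_rename_swap hab, hg.1, h1, map_mul, rename_C, ← hcx, C_mul, C_sub]
      ring
    by_cases hb : i = b
    · subst hb
      have h1 := hx a
      rw [Equiv.swap_apply_left] at h1
      rw [opU_right_rename_swap hab, hg.1, h1, map_mul, rename_C, ← hcx, C_mul, C_sub]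
      ring
    · have h1 := hx i
      rw [Equiv.swap_apply_of_ne_of_ne ha hb] at h1
      rw [rename_swap_opU_of_ne hab ha hb, hg.1, h1, map_mul, rename_C]
      ring
  -- The swapped label lies above α, so it cannot be an exponent of g; the leading coefficient comes
  -- from the swapped copy of g alone.
  · have hlt : TriGT (α.equivMapDomain (Equiv.swap a b)) α := by
      have := triGT_swap (α.equivMapDomain (Equiv.swap a b)) (a := a) (b := b) (by omega)
        (by simpa [equivMapDomain_swap_apply] using h)
      rwa [equivMapDomain_swap_swap] at this
    have h0 : coeff (α.equivMapDomain (Equiv.swap a b)) g = 0 := by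
      by_contra h0
      rcases hg.2.2 _ h0 with e | e
      · rw [e] at hlt
        exact not_triGT_self _ hlt
      · exact not_triGT_self _ (hlt.trans e)
    rw [coeff_add, coeff_rename_perm, coeff_C_mul, h0, hg.2.1, mul_zero, add_zero]

theorem rank_succ_of_eq {N : ℕ} {α : Fin N →₀ ℕ} {a b : Fin N} (hab : (a : ℕ) + 1 = b)
    (h : α a = α b) : rank α b = rank α a + 1 := by
  rw [rank_eq_card, rank_eq_card, ← Finset.card_insert_of_notMem (a := b)]
  · congr 1
    ext j
    simp only [Finset.mem_filter, Finset.mem_univ, true_and, Finset.mem_insert]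
    constructor
    · rintro (h1 | h1)
      · omega
      · by_cases hj : j = b
        · exact Or.inl hj
        · omega
    · rintro (rfl | h1) <;> omega
  · simp only [Finset.mem_filter, Finset.mem_univ, true_and]
    omega

/-- Because ξ_a - ξ_b = κ, the difference s g - g is a joint eigenvector for the spectrum with ξ_a
and ξ_b interchanged. If it were nonzero, a label with that spectrum would have the entries of α,
yet the ranks at a and b differ. -/
theorem IsNSJack.rename_swap_eq {N : ℕ} {α : Fin N →₀ ℕ} {a b : Fin N} (hab : (a : ℕ) + 1 = b)
    (h : α a = α b) {g : Pol N} (hg : IsNSJack α g) : rename (Equiv.swap a b) g = g := by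
  have hr := rank_succ_of_eq hab h
  have hxi : xi α a = xi α b + kap := by
    unfold xi
    rw [hr, h]
    push_cast
    ring
  by_contra hne
  obtain ⟨β, hβ⟩ := ne_zero_iff.1 (sub_ne_zero.2 hne)
  have he : ∀ i, opU i (rename (Equiv.swap a b) g - g) =
      C (xi α (Equiv.swap a b i)) * (rename (Equiv.swap a b) g - g) := by
    intro i
    have : rename (Equiv.swap a b) g - g = rename (Equiv.swap a b) g + C (-1) * g := by
      simp [sub_eq_add_neg]
    rw [this, opU_add, opU_C_mul, hg.1 i]
    by_cases ha : i = a
    · subst ha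
      rw [Equiv.swap_apply_left, opU_left_rename_swap hab, hg.1, map_mul, rename_C, hxi, C_add]
      simp only [map_neg, C_1]
      ring
    by_cases hb : i = b
    · subst hb
      rw [Equiv.swap_apply_right, opU_right_rename_swap hab, hg.1, map_mul, rename_C, hxi, C_add]
      simp only [map_neg, C_1]
      ring
    · rw [Equiv.swap_apply_of_ne_of_ne ha hb, rename_swap_opU_of_ne hab ha hb, hg.1, map_mul,
        rename_C]
      ring
  obtain ⟨γ, -, -, hγ⟩ := exists_xi_eq_of_eigenvector he hβ
  have hγα : γ = α := by
    ext i
    rw [← (rank_eq_and_eq_of_xi_eq (hγ i)).2, Equiv.swap_apply_def]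
    split_ifs with h1 h2
    · rw [h1, h]
    · rw [h2, h]
    · rfl
  have h1 := (rank_eq_and_eq_of_xi_eq (hγ a)).1
  rw [hγα, Equiv.swap_apply_left] at h1
  omega

theorem tilde_apply {N : ℕ} (k : Fin N) (α : Fin N →₀ ℕ) (i : Fin N) :
    tilde k α (theta k i) = α i - if i = k then 1 else 0 := by
  unfold tilde
  rw [Finsupp.equivMapDomain_apply, Equiv.symm_apply_apply, Finsupp.tsub_apply,
    Finsupp.single_apply]
  simp only [eq_comm]

theorem theta_last_castSucc {n : ℕ} (i : Fin n) : theta (Fin.last n) i.castSucc = i.succ :=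
  ((Equiv.symm_apply_eq _).1 (theta_symm_succ i)).symm

theorem theta_last_last {n : ℕ} : theta (Fin.last n) (Fin.last n) = 0 :=
  ((Equiv.symm_apply_eq _).1 theta_symm_zero).symm

/-- Lowering the last entry by one and moving it to the front trades ties on its left for strictly
larger entries. Nonvanishing keeps the subtraction from truncating. -/
theorem rank_tilde_last {n : ℕ} {α : Fin (n + 1) →₀ ℕ} (h : α (Fin.last n) ≠ 0)
    (i : Fin (n + 1)) : rank (tilde (Fin.last n) α) (theta (Fin.last n) i) = rank α i := by
  refine rank_eq_rank_of_iff _ _ fun j => ?_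
  rw [tilde_apply, tilde_apply]
  induction i using Fin.lastCases with
  | last =>
    induction j using Fin.lastCases with
    | last => simp
    | cast j =>
      have hj := (Fin.castSucc_lt_last j).ne
      simp only [theta_last_castSucc, theta_last_last, hj, if_true, if_false, Fin.le_last,
        Fin.le_zero_iff, Fin.succ_ne_zero, false_and, or_false, true_and]
      omega
  | cast i =>
    have hi := (Fin.castSucc_lt_last i).ne
    induction j using Fin.lastCases with
    | last =>
      simp only [theta_last_castSucc, theta_last_last, hi, if_true, if_false, Fin.zero_le,
        true_and, Fin.last_le_iff, false_and, or_false]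
      omega
    | cast j =>
      have hj := (Fin.castSucc_lt_last j).ne
      simp only [theta_last_castSucc, hi, hj, if_false, Nat.sub_zero, Fin.succ_le_succ_iff,
        Fin.castSucc_le_castSucc_iff]

theorem xi_last_eq {n : ℕ} {α : Fin (n + 1) →₀ ℕ} (h : α (Fin.last n) ≠ 0) :
    xi α (Fin.last n) = xi (tilde (Fin.last n) α) 0 + 1 := by
  have h1 := rank_tilde_last h (Fin.last n)
  have h2 := tilde_apply (Fin.last n) α (Fin.last n)
  rw [theta_last_last] at h1 h2
  rw [if_pos rfl] at h2
  unfold xi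
  rw [h1, h2, Nat.cast_sub (Nat.one_le_iff_ne_zero.2 h)]
  push_cast
  ring

theorem xi_castSucc_eq {n : ℕ} {α : Fin (n + 1) →₀ ℕ} (h : α (Fin.last n) ≠ 0) (i : Fin n) :
    xi α i.castSucc = xi (tilde (Fin.last n) α) i.succ := by
  have h1 := rank_tilde_last h i.castSucc
  have h2 := tilde_apply (Fin.last n) α i.castSucc
  rw [theta_last_castSucc] at h1 h2
  rw [if_neg (Fin.castSucc_lt_last i).ne, Nat.sub_zero] at h2
  unfold xi
  rw [h1, h2]

theorem raise_C_mul {n : ℕ} (c : K) (f : Pol (n + 1)) : raise (C c * f) = C c * raise f := by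
  unfold raise
  rw [map_mul, rename_C, mul_left_comm]

theorem tilde_equivMapDomain_symm {N : ℕ} (k : Fin N) (α : Fin N →₀ ℕ) :
    (tilde k α).equivMapDomain (theta k).symm = α - Finsupp.single k 1 := by
  unfold tilde
  rw [← Finsupp.equivMapDomain_trans, Equiv.self_trans_symm, Finsupp.equivMapDomain_refl]

theorem IsNSJack.raise {n : ℕ} {α : Fin (n + 1) →₀ ℕ} (h : α (Fin.last n) ≠ 0)
    {g : Pol (n + 1)} (hg : IsNSJack (tilde (Fin.last n) α) g) : IsNSJack α (raise g) := by
  refine isNSJack_of_eigenvector (fun i => ?_) ?_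
  · induction i using Fin.lastCases with
    | last =>
      rw [opU_last_raise, hg.1, raise_C_mul, xi_last_eq h, C_add, C_1]
      ring
    | cast i => rw [opU_castSucc_raise, hg.1, raise_C_mul, xi_castSucc_eq h]
  · have hα : α = Finsupp.single (Fin.last n) 1 +
        (tilde (Fin.last n) α).equivMapDomain (theta (Fin.last n)).symm := by
      rw [tilde_equivMapDomain_symm, add_tsub_cancel_of_le]
      rw [Finsupp.single_le_iff]
      omega
    unfold NSJack.raise
    nth_rw 1 [hα]
    rw [coeff_X_mul, coeff_rename_perm, hg.2.1]

/-! ### Existence, and the action of `𝒟_k` -/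

theorem isNSJack_zero {N : ℕ} : IsNSJack (0 : Fin N →₀ ℕ) 1 := by
  refine isNSJack_of_eigenvector (fun i => ?_) (by simp)
  rw [← sub_eq_zero]
  ext β
  exact coeff_eq_zero_of_mem_lower (opU_monomial_sub_mem_lower i 0) (not_triGT_zero β)

theorem sum_tilde_lt {N : ℕ} {k : Fin N} {α : Fin N →₀ ℕ} (h : α k ≠ 0) :
    ∑ i, tilde k α i < ∑ i, α i := by
  unfold tilde
  rw [sum_equivMapDomain]
  refine Finset.sum_lt_sum (fun i _ => by simp) ⟨k, Finset.mem_univ k, ?_⟩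
  simp; omega

/-- An entry at position `a` followed by zeros only moves to position `b = a + 1`. -/
theorem swap_entries {N : ℕ} {α : Fin N →₀ ℕ} {a b : Fin N} (hab : (a : ℕ) + 1 = b)
    (h0 : ∀ j, a < j → α j = 0) :
    α.equivMapDomain (Equiv.swap a b) b = α a ∧ α.equivMapDomain (Equiv.swap a b) a = 0 ∧
      ∀ j, b < j → α.equivMapDomain (Equiv.swap a b) j = 0 := by
  simp only [equivMapDomain_swap_apply, Equiv.swap_apply_left, Equiv.swap_apply_right, true_and]
  refine ⟨h0 b (by omega), fun j hj => ?_⟩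
  rw [Equiv.swap_apply_of_ne_of_ne (by omega) (by omega)]
  exact h0 j (by omega)

theorem exists_last_ne_zero {N : ℕ} {α : Fin N →₀ ℕ} (h : α ≠ 0) :
    ∃ k, α k ≠ 0 ∧ ∀ j, k < j → α j = 0 := by
  have hs : α.support.Nonempty := Finsupp.support_nonempty_iff.2 h
  refine ⟨α.support.max' hs, Finsupp.mem_support_iff.1 (α.support.max'_mem hs), fun j hj => ?_⟩
  by_contra hne
  exact absurd (α.support.le_max' j (Finsupp.mem_support_iff.2 hne)) (not_le.2 hj)

theorem exists_isNSJack {N : ℕ} (α : Fin N →₀ ℕ) : ∃ f, IsNSJack α f := by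
  induction hm : ∑ i, α i using Nat.strong_induction_on generalizing α with
  | _ m ih =>
    by_cases h : α = 0
    · exact ⟨1, h ▸ isNSJack_zero⟩
    obtain ⟨k, hk, h0⟩ := exists_last_ne_zero h
    obtain _ | n := N
    · exact k.elim0
    clear h
    induction k using Fin.reverseInduction generalizing α with
    | last =>
      obtain ⟨g, hg⟩ := ih _ (hm ▸ sum_tilde_lt hk) _ rfl
      exact ⟨_, hg.raise hk⟩
    | cast i ihk =>
      have hab : (i.castSucc : ℕ) + 1 = i.succ := by simp
      obtain ⟨h1, h2, h3⟩ := swap_entries hab h0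
      obtain ⟨g, hg⟩ := ihk (α.equivMapDomain (Equiv.swap i.castSucc i.succ))
        -- The label moved one place right is covered by the induction on k; swapping back recovers
        -- α.
        ((sum_equivMapDomain _ _).trans hm) (by rwa [h1]) h3
      have := hg.swap hab (by omega)
      rw [equivMapDomain_swap_swap] at this
      exact ⟨_, this⟩

theorem existsUnique_isNSJack {N : ℕ} (α : Fin N →₀ ℕ) : ∃! f, IsNSJack α f := by
  obtain ⟨f, hf⟩ := exists_isNSJack α
  exact ⟨f, hf, fun _ hg => hg.unique hf⟩

theorem rank_of_trailing_zeros {N : ℕ} {α : Fin N →₀ ℕ} {i : Fin N} (hi : α i = 0)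
    (h : ∀ j, i < j → α j = 0) : rank α i = (i : ℕ) + 1 := by
  rw [rank_eq_card, ← Fin.card_Iic]
  congr 1
  ext j
  simp only [Finset.mem_filter, Finset.mem_univ, true_and, Finset.mem_Iic, hi]
  constructor
  · rintro (h1 | h1)
    · by_contra h2
      exact h1.ne' (h j (not_le.1 h2))
    · exact h1.1
  · intro h1
    omega

/-- At the last position the rank is N, so the eigenvalue is 1, while 𝒰_N = x_N 𝒟_N + 1; thus x_N
𝒟_N f = 0. Invariance of f under swaps of adjacent zero entries carries the vanishing to earlier
positions. -/
theorem IsNSJack.dunkl_eq_zero {N : ℕ} {α : Fin N →₀ ℕ} {f : Pol N} (hf : IsNSJack α f)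
    (i : Fin N) (h : ∀ j, i ≤ j → α j = 0) : dunkl i f = 0 := by
  obtain _ | n := N
  · exact i.elim0
  induction i using Fin.reverseInduction with
  | last =>
    have hr := rank_of_trailing_zeros (h _ le_rfl) fun j hj => h j hj.le
    have hxi : xi α (Fin.last n) = 1 := by
      unfold xi
      rw [hr, h _ le_rfl]
      simp
    have h1 := hf.1 (Fin.last n)
    have h0 : Finset.Ioi (Fin.last n) = ∅ := by ext j; simp [Fin.le_last]
    rw [opU_eq, h0, hxi, C_1, one_mul, Finset.sum_empty, mul_zero, add_zero,
      add_eq_right] at h1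
    exact (mul_eq_zero.1 h1).resolve_left (X_ne_zero _)
  | cast i ih =>
    have hlt : i.castSucc < i.succ := Fin.castSucc_lt_succ
    have hs := hf.rename_swap_eq (a := i.castSucc) (b := i.succ) (by simp)
      ((h _ le_rfl).trans (h _ hlt.le).symm)
    have h1 := rename_dunkl (Equiv.swap i.castSucc i.succ) i.succ f
    rw [Equiv.swap_apply_right, hs, ih fun j hj => h j (hlt.le.trans hj), map_zero] at h1
    exact h1.symm

theorem theta_succ_apply {n : ℕ} (i : Fin n) (x : Fin (n + 1)) :
    theta i.succ x = theta i.castSucc (Equiv.swap i.castSucc i.succ x) := by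
  have hlt : i.castSucc < i.succ := Fin.castSucc_lt_succ
  unfold theta
  rcases lt_trichotomy x i.castSucc with h | rfl | h
  · rw [Equiv.swap_apply_of_ne_of_ne h.ne (h.trans hlt).ne, Fin.cycleRange_of_lt (h.trans hlt),
      Fin.cycleRange_of_lt h]
  · rw [Equiv.swap_apply_left, Fin.cycleRange_of_lt hlt, Fin.cycleRange_of_gt hlt]
    simp
  · rcases eq_or_lt_of_le (Fin.castSucc_lt_iff_succ_le.1 h) with rfl | h'
    · rw [Equiv.swap_apply_right, Fin.cycleRange_self, Fin.cycleRange_self]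
    · rw [Equiv.swap_apply_of_ne_of_ne h.ne' h'.ne', Fin.cycleRange_of_gt h',
        Fin.cycleRange_of_gt h]

/-- Since θ_{k+1} = θ_k (k, k+1), moving the last nonzero entry one step right leaves α̃ unchanged,
so the same g serves throughout the induction on k. -/
theorem tilde_swap {n : ℕ} (i : Fin n) (α : Fin (n + 1) →₀ ℕ) :
    tilde i.succ (α.equivMapDomain (Equiv.swap i.castSucc i.succ)) = tilde i.castSucc α := by
  ext y
  obtain ⟨x, rfl⟩ := (theta i.succ).surjective y
  rw [tilde_apply, theta_succ_apply, tilde_apply, equivMapDomain_swap_apply]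
  congr 2
  rw [Equiv.swap_apply_eq_iff, Equiv.swap_apply_left]

theorem rename_swap_rename_theta_symm {n : ℕ} (i : Fin n) (g : Pol (n + 1)) :
    rename (Equiv.swap i.castSucc i.succ) (rename (theta i.succ).symm g) =
      rename (theta i.castSucc).symm g := by
  rw [rename_rename]
  congr 2
  funext x
  rw [Function.comp_apply, Equiv.eq_symm_apply, ← theta_succ_apply, Equiv.apply_symm_apply]

/-- If the last nonzero entry of `α` stands at `a` and `b = a + 1`, then the passage from the
label `(a b) α` to the label `α` relates `𝒟_a` to `𝒟_b`. -/
theorem IsNSJack.dunkl_swap {N : ℕ} {α : Fin N →₀ ℕ} {a b : Fin N} (hab : (a : ℕ) + 1 = b)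
    (ha : α a ≠ 0) (h0 : ∀ j, a < j → α j = 0) {f g : Pol N} (hf : IsNSJack α f)
    (hg : IsNSJack (α.equivMapDomain (Equiv.swap a b)) g) :
    dunkl a f = C (1 - (kap / (xi α a - xi α b)) ^ 2) *
      rename (Equiv.swap a b) (dunkl b g) := by
  obtain ⟨h1, h2, h3⟩ := swap_entries hab h0
  have hb : α b = 0 := h0 b (by omega)
  have hne : α a ≠ α b := by omega
  have hfg := hg.swap hab (by omega)
  rw [equivMapDomain_swap_swap] at hfg
  have hxa := xi_swap hab hne a
  have hxb := xi_swap hab hne b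
  rw [Equiv.swap_apply_left] at hxa
  rw [Equiv.swap_apply_right] at hxb
  rw [hxa, hxb] at hfg
  obtain rfl := hf.unique hfg
  set c := kap / (xi α a - xi α b)
  have hDa := rename_dunkl (Equiv.swap a b) b g
  have hDb := rename_dunkl (Equiv.swap a b) a g
  rw [Equiv.swap_apply_right] at hDa
  rw [Equiv.swap_apply_left] at hDb
  have hz := hf.dunkl_eq_zero b fun j hj => h0 j (by omega)
  rw [dunkl_add, dunkl_C_mul, ← hDb] at hz
  -- Applying the swap to 𝒟_b f = 0 isolates 𝒟_a g in terms of 𝒟_b g.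
  have hz' := congrArg (rename (Equiv.swap a b)) hz
  rw [map_add, map_mul, rename_C, rename_swap_swap, map_zero] at hz'
  rw [dunkl_add, dunkl_C_mul, ← hDa, eq_neg_of_add_eq_zero_left hz', C_sub, C_pow, C_1]
  ring

theorem dunkl_isNSJack {n : ℕ} (k : Fin (n + 1)) {α : Fin (n + 1) →₀ ℕ} (hk : α k ≠ 0)
    (h0 : ∀ j, k < j → α j = 0) {f g : Pol (n + 1)} (hf : IsNSJack α f)
    (hg : IsNSJack (tilde k α) g) :
    dunkl k f =
      C (((((k : ℕ) + 1 : K) - (rank α k : K)) * kap + (α k : K)) /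
            ((((k : ℕ) + 1 : K) + 1 - (rank α k : K)) * kap + (α k : K)) *
          ((((n + 1 : ℕ) : K) + 1 - (rank α k : K)) * kap + (α k : K))) *
        rename (theta k).symm g := by
  -- All denominators have constant term α_k ≠ 0 as polynomials in κ.
  have hlin (m : ℤ) : (m : K) * kap + (α k : K) ≠ 0 := by
    exact_mod_cast mul_kap_add_ne_zero m (b := α k) (by exact_mod_cast hk)
  induction k using Fin.reverseInduction generalizing α f with
  | last =>
    obtain rfl := hf.unique (hg.raise hk)
    rw [dunkl_last_raise, hg.1, map_mul, rename_C]
    congr 2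
    have hx := xi_last_eq hk
    have hx' := eq_sub_of_add_eq hx.symm
    have hd := hlin ((n : ℤ) + 1 + 1 - rank α (Fin.last n))
    push_cast at hd
    rw [hx', Fin.val_last, Nat.cast_add, Nat.cast_one, div_mul_cancel₀ _ hd]
    unfold xi
    push_cast
    ring
  | cast i ih =>
    have hab : (i.castSucc : ℕ) + 1 = i.succ := by simp
    obtain ⟨h1, h2, h3⟩ := swap_entries hab h0
    have hb : α i.succ = 0 := h0 _ Fin.castSucc_lt_succ
    obtain ⟨h, hh⟩ := exists_isNSJack (α.equivMapDomain (Equiv.swap i.castSucc i.succ))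
    have hr : rank (α.equivMapDomain (Equiv.swap i.castSucc i.succ)) i.succ =
        rank α i.castSucc := by
      have := rank_swap hab (by omega : α i.castSucc ≠ α i.succ) i.castSucc
      rwa [Equiv.swap_apply_left] at this
    have hD := ih (by rwa [h1]) h3 hh (by rwa [tilde_swap]) (by rwa [h1])
    rw [hf.dunkl_swap hab hk h0 hh, hD, map_mul, rename_C, rename_swap_rename_theta_symm,
      ← mul_assoc, ← C_mul, hr, h1]
    congr 2
    have hrb := rank_of_trailing_zeros hb fun j hj => h0 j (Fin.castSucc_lt_succ.trans hj)
    have hx : xi α i.castSucc - xi α i.succ =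
        ((i : ℕ) + 1 + 1 - (rank α i.castSucc : K)) * kap + (α i.castSucc : K) := by
      unfold xi
      rw [hrb, hb, Fin.val_succ]
      push_cast
      ring
    have hd1 := hlin ((i : ℕ) + 1 + 1 - rank α i.castSucc)
    have hd2 := hlin ((i : ℕ) + 1 + 1 + 1 - rank α i.castSucc)
    push_cast at hd1 hd2
    rw [hx, Fin.val_succ, Fin.val_castSucc, Nat.cast_add, Nat.cast_one]
    rw [← mul_assoc]
    congr 1
    -- Here 1 - c² = (A - κ)(A + κ)/A², and the induction hypothesis contributes A/(A + κ); the
    -- product is (A - κ)/A.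
    set A := ((i : ℕ) + 1 + 1 - (rank α i.castSucc : K)) * kap + (α i.castSucc : K) with hA
    have e1 : ((i : ℕ) + 1 - (rank α i.castSucc : K)) * kap + (α i.castSucc : K) = A - kap := by
      rw [hA]; ring
    have e3 : ((i : ℕ) + 1 + 1 + 1 - (rank α i.castSucc : K)) * kap + (α i.castSucc : K) =
        A + kap := by
      rw [hA]; ring
    rw [e3] at hd2 ⊢
    rw [e1]
    field_simp
    ring

theorem apply_ne_zero_of_len {N : ℕ} {α : Fin N →₀ ℕ} {k : Fin N} (hk : len α = (k : ℕ) + 1) :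
    α k ≠ 0 ∧ ∀ j, k < j → α j = 0 := by
  have hα : α ≠ 0 := by
    rintro rfl
    simp [len] at hk
  obtain ⟨m, hm, h0⟩ := exists_last_ne_zero hα
  have hlen : len α = (m : ℕ) + 1 := by
    refine le_antisymm (Finset.sup_le fun j hj => ?_)
      (Finset.le_sup (f := fun j : Fin N => (j : ℕ) + 1) (Finsupp.mem_support_iff.2 hm))
    by_contra hlt
    exact Finsupp.mem_support_iff.1 hj (h0 j (by omega))
  obtain rfl : m = k := Fin.ext (by omega)
  exact ⟨hm, h0⟩

theorem isNSJack_zeta {N : ℕ} (α : Fin N →₀ ℕ) : IsNSJack α (zeta α) :=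
  Classical.epsilon_spec (exists_isNSJack α)

end NSJack

end

theorem mainTheorem7 (N : ℕ) (α : Fin N →₀ ℕ) (k : Fin N)
    (hk : NSJack.len α = (k : ℕ) + 1) :
    (∃! f : NSJack.Pol N, NSJack.IsNSJack α f) ∧
    (∃! f : NSJack.Pol N, NSJack.IsNSJack (NSJack.tilde k α) f) ∧
    NSJack.dunkl k (NSJack.zeta α) =
      MvPolynomial.C
        (((((k : ℕ) + 1 : NSJack.K) - (NSJack.rank α k : NSJack.K)) * NSJack.kap
              + (α k : NSJack.K)) /
            ((((k : ℕ) + 1 : NSJack.K) + 1 - (NSJack.rank α k : NSJack.K)) * NSJack.kap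
              + (α k : NSJack.K)) *
          (((N : NSJack.K) + 1 - (NSJack.rank α k : NSJack.K)) * NSJack.kap
              + (α k : NSJack.K))) *
        MvPolynomial.rename (⇑(NSJack.theta k).symm) (NSJack.zeta (NSJack.tilde k α)) := by
  refine ⟨NSJack.existsUnique_isNSJack _, NSJack.existsUnique_isNSJack _, ?_⟩
  obtain ⟨h1, h2⟩ := NSJack.apply_ne_zero_of_len hk
  obtain _ | n := N
  · exact k.elim0
  · exact NSJack.dunkl_isNSJack k h1 h2 (NSJack.isNSJack_zeta _) (NSJack.isNSJack_zeta _)
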